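/- **Proposition (three-term relation for $S_{4,2}$).** For integers $n,p\ge 1$ and $z\in\mathbb{C}\setminus[1,\infty)$ let $$S_{n,p}(z)=\frac{(-1)^{n+p-1}}{(n-1)!\,p!}\int_0^1\log^{n-1}(t)\,\log^p(1-zt)\,\frac{dt}{t}$$ be the Nielsen polylogarithm, and let $\mathrm{Li}_1(z)=-\log(1-z)$, $\mathrm{Li}_m(z)=\int_0^z\mathrm{Li}_{m-1}(s)\,\frac{ds}{s}$ ($m\ge2$, integration along the straight segment from $0$ to $z$) be the classical polylogarithms on $\mathbb{C}\setminus[1,\infty)$; $\log$ is the principal branch and $\zeta$ is the Riemann zeta function. Then for all $z\in\mathbb{C}\setminus\big((-\infty,0]\cup[1,\infty)\big)$, $$\begin{aligned} &S_{4,2}(1-z)+S_{4,2}(z)+S_{4,2}\Big(\frac{z}{z-1}\Big)\\ &=2\,\mathrm{Li}_6(1-z)+2\,\mathrm{Li}_6(z)+2\,\mathrm{Li}_6\Big(\frac{z}{z-1}\Big)-\Big(\mathrm{Li}_5(z)-\mathrm{Li}_5\Big(\frac{z}{z-1}\Big)\Big)\log(1-z)-\mathrm{Li}_5(1-z)\log(z)\\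 &\quad-\frac{3}{6!}\log^6(1-z)+\frac{2}{5!}\log(z)\log^5(1-z)-\frac{1}{2!\,4!}\log^2(z)\log^4(1-z)-\frac{2}{4!}\zeta(2)\log^4(1-z)\\ &\quad+\frac{1}{3!}\zeta(2)\log(z)\log^3(1-z)-\frac{1}{3!}\zeta(3)\log^3(1-z)+\frac{1}{2!}\zeta(3)\log(z)\log^2(1-z)-\frac{7}{4\cdot2!}\zeta(4)\log^2(1-z)\\ &\quad+\zeta(4)\log(z)\log(1-z)+\zeta(5)\log(z)-\zeta(2)\zeta(3)\log(1-z)-\Big(\frac12\zeta(3)^2+\frac54\zeta(6)\Big). \end{aligned}$$ -/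

import Mathlib

/-- The principal branch of the classical polylogarithm `Li_m` on the plane cut along `[1, ∞)`:
`Li_1(z) = -log(1 - z)` and `Li_m(z) = ∫_0^z Li_{m-1}(s) ds/s` for `m ≥ 2`, where the path is
the straight segment `s = t z`, `0 ≤ t ≤ 1`, so that `ds/s = dt/t`.
The case `m = 0` is the usual `Li_0(z) = z/(1 - z)`. -/
noncomputable def classicalPolylog : ℕ → ℂ → ℂ
  | 0, z => z / (1 - z)
  | 1, z => -Complex.log (1 - z)
  | m + 2, z => ∫ t in (0 : ℝ)..1, classicalPolylog (m + 1) ((t : ℂ) * z) / (t : ℂ)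

/-- Nielsen's generalised polylogarithm, for `n, p ≥ 1`, on the plane cut along `[1, ∞)`:
`S_{n,p}(z) = (-1)^(n+p-1) / ((n-1)! p!) * ∫_0^1 log^(n-1)(t) log^p(1 - z t) dt/t`. -/
noncomputable def nielsenPolylog (n p : ℕ) (z : ℂ) : ℂ :=
  (-1 : ℂ) ^ (n + p - 1) / (((n - 1).factorial : ℂ) * (p.factorial : ℂ)) *
    ∫ t in (0 : ℝ)..1,
      (Real.log t : ℂ) ^ (n - 1) * Complex.log (1 - z * (t : ℂ)) ^ p / (t : ℂ)

/-!
Up to sign and factorials, `log^p (1 - z)` is the bottom of a tower of iterated integrals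
`U (n + 1)(z) = ∫₀ᶻ U n (s) ds / s`, and `S_{n,p}` is its `n`-th floor. Under `z ↦ 1 - z` and
`z ↦ z / (z - 1)` the form `dz / z` changes by a multiple of `dz / (1 - z)`, and multiplication of
the generating function `∑ U n Tⁿ` by an exponential of `T` times a logarithm absorbs this change:
the coefficients of the product have elementary derivatives, resp. derivatives known from the
previous coefficient. This determines them on the doubly cut plane up to their limits as `z → 0⁺`.
Multiplication by the inverse exponential gives closed formulas for `S_{n,p}(1 - z)` and
`S_{n,p}(z / (z - 1))` in terms of logarithms, the `S_{m,q}(z)` and the values at `1`, which are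
`ζ(n + 1)` for `p = 1` and the double zeta values `ζ(n + 1, 1)` for `p = 2`. The latter are
polynomials in zeta values by Euler's sum formula and the stuffle product, and in the three-term
combination all the remaining `S_{m,q}(z)` cancel.
-/

open Complex Set Filter Topology MeasureTheory intervalIntegral
open scoped Nat

/-- The truncated exponential convolution `∑ xʲ / j! · a (n - j)`, the `n`-th coefficient of
`exp (x T) · ∑ a m Tᵐ`. -/
def expConv {K : Type*} [Field K] (x : K) (a : ℕ → K) (n : ℕ) : K :=
  ∑ j ∈ Finset.range (n + 1), x ^ j / (j ! : K) * a (n - j)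

section ExpConv

variable {K : Type*} [Field K]

theorem expConv_zero (a : ℕ → K) : expConv 0 a = a := by
  funext n
  rw [expConv, Finset.sum_range_succ', Finset.sum_eq_zero fun j _ => by simp]
  simp

theorem expConv_succ (x : K) (a : ℕ → K) (n : ℕ) :
    expConv x a (n + 1) =
      expConv x (fun m => a (m + 1)) n + x ^ (n + 1) / ((n + 1)! : K) * a 0 := by
  rw [expConv, Finset.sum_range_succ, Nat.sub_self, expConv]
  refine congrArg (· + _) (Finset.sum_congr rfl fun j hj => ?_)
  rw [Nat.sub_add_comm (Nat.lt_succ_iff.1 (Finset.mem_range.1 hj))]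

theorem mk_expConv [CharZero K] (x : K) (a : ℕ → K) :
    PowerSeries.mk (expConv x a) =
      PowerSeries.rescale x (PowerSeries.exp K) * PowerSeries.mk a := by
  ext n
  simp [PowerSeries.coeff_mul, Finset.Nat.sum_antidiagonal_eq_sum_range_succ_mk, expConv,
    PowerSeries.coeff_exp, div_eq_mul_inv]

theorem expConv_neg_expConv [CharZero K] (x : K) (a : ℕ → K) :
    expConv (-x) (expConv x a) = a := by
  have h : PowerSeries.mk (expConv (-x) (expConv x a)) = PowerSeries.mk a := by
    rw [mk_expConv, mk_expConv, ← mul_assoc, PowerSeries.exp_mul_exp_eq_exp_add, neg_add_cancel]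
    simp
  funext n
  simpa using congrArg (PowerSeries.coeff n) h

theorem pow_div_factorial_mul_pow_div_factorial [CharZero K] (x : K) (m n : ℕ) :
    x ^ m / (m ! : K) * (x ^ n / (n ! : K)) =
      ((m + n).choose m : K) * (x ^ (m + n) / ((m + n)! : K)) := by
  have hm : (m ! : K) ≠ 0 := Nat.cast_ne_zero.2 m.factorial_ne_zero
  have hn : (n ! : K) ≠ 0 := Nat.cast_ne_zero.2 n.factorial_ne_zero
  have hmn : ((m + n)! : K) ≠ 0 := Nat.cast_ne_zero.2 (m + n).factorial_ne_zero
  rw [Nat.cast_add_choose, pow_add]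
  field_simp

theorem tendsto_expConv [TopologicalSpace K] [IsTopologicalRing K] {ι : Type*} {l : Filter ι}
    {e : ι → K} {x : K} {a : ℕ → ι → K} {s : ℕ → K} (he : Tendsto e l (𝓝 x))
    (ha : ∀ m, Tendsto (a m) l (𝓝 (s m))) (n : ℕ) :
    Tendsto (fun i => expConv (e i) (fun m => a m i) n) l (𝓝 (expConv x s n)) := by
  simp only [expConv, div_eq_mul_inv]
  exact tendsto_finsetSum _ fun j _ => ((he.pow j).mul_const _).mul (ha (n - j))

theorem hasDerivAt_pow_succ_div_factorial {𝕜 : Type*} [NontriviallyNormedField 𝕜] [CharZero 𝕜]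
    {e : 𝕜 → 𝕜} {e' z : 𝕜} (he : HasDerivAt e e' z) (j : ℕ) :
    HasDerivAt (fun z => e z ^ (j + 1) / ((j + 1)! : 𝕜)) (e z ^ j / (j ! : 𝕜) * e') z := by
  refine ((he.fun_pow (j + 1)).div_const _).congr_deriv ?_
  have hj : (j : 𝕜) + 1 ≠ 0 := j.cast_add_one_ne_zero
  have hj' : (j ! : 𝕜) ≠ 0 := Nat.cast_ne_zero.2 j.factorial_ne_zero
  rw [Nat.factorial_succ]
  push_cast
  field_simp

/-- Multiplication by `exp (e T)` removes the term `-e' U (m - 1)` from the derivative of `U m`. -/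
theorem hasDerivAt_expConv {𝕜 : Type*} [NontriviallyNormedField 𝕜] [CharZero 𝕜] {e : 𝕜 → 𝕜}
    {e' z : 𝕜} {U : ℕ → 𝕜 → 𝕜} {V : ℕ → 𝕜} (he : HasDerivAt e e' z)
    (hU₀ : HasDerivAt (U 0) (V 0) z)
    (hU : ∀ m, HasDerivAt (U (m + 1)) (V (m + 1) - e' * U m z) z) (n : ℕ) :
    HasDerivAt (fun w => expConv (e w) (fun m => U m w) n) (expConv (e z) V n) z := by
  induction n generalizing U V with
  | zero => simpa [expConv] using hU₀
  | succ n ih =>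
    have h₀ : HasDerivAt (fun w => e w ^ (n + 1) / ((n + 1)! : 𝕜) * U 0 w) _ z :=
      (hasDerivAt_pow_succ_div_factorial he n).mul hU₀
    have h := ih (U := fun m => U (m + 1))
      (V := fun m => V (m + 1) - if m = 0 then e' * U 0 z else 0)
      (by simpa using hU 0) fun m => by simpa using hU (m + 1)
    simp only [expConv_succ]
    refine (h.fun_add h₀).congr_deriv ?_
    have hlow : ∀ j ∈ Finset.range n, ¬n - j = 0 := fun j hj =>
      (Nat.sub_pos_of_lt (Finset.mem_range.1 hj)).ne'
    simp only [expConv, mul_sub, Finset.sum_sub_distrib, Finset.sum_range_succ _ n, mul_ite,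
      mul_zero, Finset.sum_ite_of_false hlow, Nat.sub_self, if_true, Finset.sum_const_zero]
    ring

theorem hasDerivAt_expConv_of_forall_eq_neg_mul {𝕜 : Type*} [NontriviallyNormedField 𝕜]
    [CharZero 𝕜] {e : 𝕜 → 𝕜} {e' z : 𝕜} {U : ℕ → 𝕜 → 𝕜} {v : 𝕜} (he : HasDerivAt e e' z)
    (hU₀ : HasDerivAt (U 0) v z) (hU : ∀ m, HasDerivAt (U (m + 1)) (-(e' * U m z)) z) (n : ℕ) :
    HasDerivAt (fun w => expConv (e w) (fun m => U m w) n) (e z ^ n / (n ! : 𝕜) * v) z := by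
  refine (hasDerivAt_expConv (V := Pi.single 0 v) he (by simpa using hU₀)
    (fun m => by simpa using hU m) n).congr_deriv ?_
  cases n with
  | zero => simp [expConv]
  | succ n =>
    rw [expConv_succ]
    simp [expConv]

end ExpConv

section DoubleZeta

/-- The zeta value `ζ(k)` as a real number, for `k ≥ 2`. -/
noncomputable def realZeta (k : ℕ) : ℝ := ∑' n : ℕ+, 1 / (n : ℝ) ^ k

/-- The double zeta value `ζ(k, l) = ∑_{m > n ≥ 1} m⁻ᵏ n⁻ˡ`, for `k ≥ 2` and `l ≥ 1`; the sum runs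
over the pairs `q = (m - n, n)`. -/
noncomputable def doubleZeta (k l : ℕ) : ℝ :=
  ∑' q : ℕ+ × ℕ+, 1 / (((q.1 : ℝ) + q.2) ^ k * (q.2 : ℝ) ^ l)

theorem one_le_pnat_cast (n : ℕ+) : (1 : ℝ) ≤ n := by exact_mod_cast PNat.pos n

theorem summable_one_div_pnat_pow {k : ℕ} (hk : 2 ≤ k) :
    Summable fun n : ℕ+ => 1 / (n : ℝ) ^ k :=
  summable_pnat_iff_summable_nat.2 (Real.summable_one_div_nat_pow.2 hk)

theorem realZeta_eq_tsum_nat {k : ℕ} (hk : 2 ≤ k) : realZeta k = ∑' n : ℕ, 1 / (n : ℝ) ^ k := by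
  rw [realZeta, ← tsum_zero_pnat_eq_tsum_nat (Real.summable_one_div_nat_pow.2 hk)]
  simp [show k ≠ 0 by lia]

theorem riemannZeta_ofNat_eq_realZeta (k : ℕ) [k.AtLeastTwo] :
    riemannZeta ofNat(k) = (realZeta ofNat(k) : ℂ) := by
  have hk : 2 ≤ k := Nat.AtLeastTwo.prop
  change riemannZeta (k : ℂ) = (realZeta k : ℂ)
  rw [zeta_nat_eq_tsum_of_gt_one hk, realZeta_eq_tsum_nat hk]
  push_cast
  rfl

theorem summable_tornheim :
    Summable fun q : ℕ+ × ℕ+ => 1 / ((q.1 : ℝ) * q.2 * (q.1 + q.2)) := by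
  have h : Summable fun n : ℕ+ => 1 / (n : ℝ) ^ (3 / 2 : ℝ) :=
    summable_pnat_iff_summable_nat.2 (Real.summable_one_div_nat_rpow.2 (by norm_num))
  refine (h.mul_of_nonneg h (fun _ => by positivity) fun _ => by positivity).of_nonneg_of_le
    (fun q => by positivity) fun q => ?_
  have hsqrt : √((q.1 : ℝ) * q.2) ≤ q.1 + q.2 :=
    (Real.sqrt_le_left (by positivity)).2
      (by nlinarith [one_le_pnat_cast q.1, one_le_pnat_cast q.2])
  rw [one_div_mul_one_div, ← Real.mul_rpow (by positivity) (by positivity),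
    show (3 / 2 : ℝ) = 1 + 1 / 2 by norm_num, Real.rpow_add (by positivity), Real.rpow_one,
    ← Real.sqrt_eq_rpow]
  gcongr

theorem summable_doubleZeta {k l : ℕ} (hk : 2 ≤ k) (hl : 1 ≤ l) :
    Summable fun q : ℕ+ × ℕ+ => 1 / (((q.1 : ℝ) + q.2) ^ k * (q.2 : ℝ) ^ l) := by
  refine summable_tornheim.of_nonneg_of_le (fun q => by positivity) fun q => ?_
  have h₁ := one_le_pnat_cast q.1
  have h₂ := one_le_pnat_cast q.2
  refine one_div_le_one_div_of_le (by positivity) ?_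
  calc (q.1 : ℝ) * q.2 * (q.1 + q.2) ≤ (q.1 + q.2) ^ 2 * q.2 ^ 1 := by
        rw [pow_one, mul_right_comm, sq]
        gcongr
        linarith
    _ ≤ (q.1 + q.2) ^ k * q.2 ^ l := by
        gcongr
        linarith

theorem tsum_swap_eq_doubleZeta (k l : ℕ) :
    ∑' q : ℕ+ × ℕ+, 1 / (((q.1 : ℝ) + q.2) ^ k * (q.1 : ℝ) ^ l) = doubleZeta k l := by
  rw [doubleZeta, ← (Equiv.prodComm ℕ+ ℕ+).tsum_eq]
  simp only [Equiv.prodComm_apply, Prod.fst_swap, Prod.snd_swap, add_comm]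

theorem bijective_pnat_prod_trichotomy :
    Function.Bijective (Sum.elim (fun q : ℕ+ × ℕ+ => (q.1, q.1 + q.2))
      (Sum.elim (fun q : ℕ+ × ℕ+ => (q.1 + q.2, q.2)) fun n : ℕ+ => (n, n))) := by
  constructor
  · rintro (⟨a, b⟩ | ⟨a, b⟩ | a) (⟨c, d⟩ | ⟨c, d⟩ | c) h
    all_goals
      simp only [Sum.elim_inl, Sum.elim_inr, Prod.mk.injEq, ← PNat.coe_inj, PNat.add_coe,
        Sum.inl.injEq, Sum.inr.injEq, reduceCtorEq] at h ⊢
      grind [PNat.pos]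
  · rintro ⟨a, b⟩
    rcases lt_trichotomy a b with h | rfl | h
    · exact ⟨.inl (a, b - a), by simp [PNat.add_sub_of_lt h]⟩
    · exact ⟨.inr (.inr a), rfl⟩
    · exact ⟨.inr (.inl (a - b, b)), by simp [PNat.sub_add_of_lt h]⟩

theorem tsum_pnat_prod {F : ℕ+ × ℕ+ → ℝ} (hF : Summable F) :
    ∑' q, F q =
      ∑' q : ℕ+ × ℕ+, F (q.1, q.1 + q.2) + ∑' q : ℕ+ × ℕ+, F (q.1 + q.2, q.2) +
        ∑' n, F (n, n) := by
  set e := Equiv.ofBijective _ bijective_pnat_prod_trichotomy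
  have hs : Summable (F ∘ e) := e.summable_iff.2 hF
  have hs' := hs.comp_injective Sum.inr_injective
  rw [← e.tsum_eq, add_assoc]
  refine ((hs.comp_injective Sum.inl_injective).tsum_sum hs').trans ?_
  exact congrArg (_ + ·) ((hs'.comp_injective Sum.inl_injective).tsum_sum
    (hs'.comp_injective Sum.inr_injective))

theorem realZeta_mul_realZeta {k l : ℕ} (hk : 2 ≤ k) (hl : 2 ≤ l) :
    realZeta k * realZeta l = doubleZeta k l + doubleZeta l k + realZeta (k + l) := by
  have hs := (summable_one_div_pnat_pow hk).mul_of_nonneg (summable_one_div_pnat_pow hl)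
    (fun _ => by positivity) fun _ => by positivity
  rw [realZeta, realZeta, (summable_one_div_pnat_pow hk).tsum_mul_tsum
    (summable_one_div_pnat_pow hl) hs, tsum_pnat_prod hs, ← tsum_swap_eq_doubleZeta l k,
    add_comm (doubleZeta k l)]
  simp only [doubleZeta, realZeta, PNat.add_coe, Nat.cast_add, one_div_mul_one_div, pow_add,
    mul_comm]

theorem hasSum_sub_succ_of_antitone {f : ℕ → ℝ} {l : ℝ} (hf : Antitone f)
    (hl : Tendsto f atTop (𝓝 l)) : HasSum (fun n => f n - f (n + 1)) (f 0 - l) := by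
  rw [hasSum_iff_tendsto_nat_of_nonneg fun n => sub_nonneg.2 (hf n.le_succ)]
  simp only [Finset.sum_range_sub']
  exact tendsto_const_nhds.sub hl

theorem hasSum_one_div_sub_one_div_add (a : ℕ) :
    HasSum (fun b : ℕ+ => 1 / (b : ℝ) - 1 / ((b : ℝ) + a)) (harmonic a) := by
  induction a with
  | zero => simp
  | succ a ih =>
    have hanti : Antitone fun j : ℕ => 1 / ((j : ℝ) + 1 + a) := fun i j hij => by
      simp only
      gcongr
    have hlim : Tendsto (fun j : ℕ => 1 / ((j : ℝ) + 1 + a)) atTop (𝓝 0) := by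
      refine (((tendsto_add_atTop_iff_nat a).2
        (tendsto_one_div_add_atTop_nhds_zero_nat (𝕜 := ℝ)))).congr fun j => ?_
      push_cast
      ring
    have h : HasSum (fun b : ℕ+ => 1 / ((b : ℝ) + a) - 1 / ((b : ℝ) + 1 + a))
        (1 / ((a : ℝ) + 1)) := by
      rw [← Equiv.pnatEquivNat.symm.hasSum_iff]
      simpa [Function.comp_def, add_comm (a : ℝ)] using hasSum_sub_succ_of_antitone hanti hlim
    rw [harmonic_succ]
    push_cast
    convert ih.add h using 2 <;> ring

theorem hasSum_ite_le_one_div (a : ℕ) :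
    HasSum (fun b : ℕ+ => if b ≤ a then 1 / (b : ℝ) else 0) (harmonic a) := by
  induction a with
  | zero => simp [PNat.ne_zero]
  | succ a ih =>
    rw [harmonic_succ]
    push_cast
    refine (ih.add (hasSum_ite_eq a.succPNat ((a : ℝ) + 1)⁻¹)).congr_fun fun b => ?_
    rcases eq_or_ne b a.succPNat with rfl | hb
    · simp
    · have : (b : ℕ) ≤ a + 1 ↔ (b : ℕ) ≤ a :=
        (Nat.le_iff_lt_or_eq.trans (or_iff_left fun h => hb (PNat.eq h))).trans Nat.lt_succ_iff
      simp [hb, this]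

theorem hasSum_tornheim_row (r : ℕ) (a : ℕ+) :
    HasSum (fun b : ℕ+ => 1 / ((a : ℝ) ^ r * b * (a + b)))
      (1 / (a : ℝ) ^ (r + 1) * harmonic a) := by
  refine ((hasSum_one_div_sub_one_div_add a).mul_left _).congr_fun fun b => ?_
  field_simp
  ring

/-- Both sides are equal to `∑ H_a / aʳ⁺¹`: on the left the sum over `b` telescopes after a partial
fraction decomposition, on the right `H_a` is the sum of `1 / b` over `b ≤ a`. -/
theorem tsum_tornheim_eq {r : ℕ} (hr : 1 ≤ r) :
    ∑' q : ℕ+ × ℕ+, 1 / ((q.1 : ℝ) ^ r * q.2 * (q.1 + q.2)) =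
      realZeta (r + 2) + doubleZeta (r + 1) 1 := by
  set T : ℕ+ × ℕ+ → ℝ := fun q => 1 / ((q.1 : ℝ) ^ r * q.2 * (q.1 + q.2)) with hT
  set G : ℕ+ × ℕ+ → ℝ := fun q =>
    if q.2 ≤ q.1 then 1 / ((q.1 : ℝ) ^ (r + 1) * q.2) else 0 with hG
  have hTs : Summable T := by
    refine summable_tornheim.of_nonneg_of_le (fun q => by positivity) fun q => ?_
    have := le_self_pow₀ (one_le_pnat_cast q.1) (by lia : r ≠ 0)
    simp only [hT]
    gcongr
  have hTrow (a : ℕ+) : HasSum (fun b => T (a, b)) (1 / (a : ℝ) ^ (r + 1) * harmonic a) :=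
    hasSum_tornheim_row r a
  have hGrow (a : ℕ+) : HasSum (fun b => G (a, b)) (1 / (a : ℝ) ^ (r + 1) * harmonic a) := by
    refine ((hasSum_ite_le_one_div a).mul_left _).congr_fun fun b => ?_
    simp only [hG, PNat.coe_le_coe, mul_ite, mul_zero, one_div_mul_one_div]
  have hGs : Summable G := by
    refine (summable_prod_of_nonneg fun q => ?_).2 ⟨fun a => (hGrow a).summable, ?_⟩
    · simp only [hG]
      split_ifs
      · positivity
      · rfl
    · simpa only [(hGrow _).tsum_eq, (hTrow _).tsum_eq] using hTs.prod
  have hTG : ∑' q, T q = ∑' q, G q := by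
    simp only [hTs.tsum_prod, hGs.tsum_prod, (hGrow _).tsum_eq, (hTrow _).tsum_eq]
  rw [hTG, tsum_pnat_prod hGs]
  have hlt : ∀ q : ℕ+ × ℕ+, G (q.1, q.1 + q.2) = 0 := fun q =>
    if_neg (PNat.lt_add_right _ _).not_ge
  have hgt : ∀ q : ℕ+ × ℕ+, G (q.1 + q.2, q.2) = 1 / (((q.1 : ℝ) + q.2) ^ (r + 1) * q.2 ^ 1) :=
    fun q => by simp [hG, (PNat.lt_add_left q.2 q.1).le]
  have heq : ∀ n : ℕ+, G (n, n) = 1 / (n : ℝ) ^ (r + 2) := fun n => by simp [hG, pow_succ]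
  simp only [hlt, hgt, heq, tsum_zero, zero_add, realZeta, doubleZeta, add_comm]

theorem sum_one_div_add_pow_mul_pow (r : ℕ) {a b : ℝ} (ha : 0 < a) (hb : 0 < b) :
    ∑ k ∈ Finset.range r, 1 / ((a + b) ^ (k + 2) * a ^ (r - k)) + 1 / ((a + b) ^ (r + 1) * b) =
      1 / (a ^ r * b * (a + b)) := by
  induction r with
  | zero => simp; ring
  | succ r ih =>
    have e : ∀ k ∈ Finset.range r, 1 / ((a + b) ^ (k + 2) * a ^ (r + 1 - k)) =
        1 / a * (1 / ((a + b) ^ (k + 2) * a ^ (r - k))) := fun k hk => by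
      rw [Nat.succ_sub (Finset.mem_range.1 hk).le, Nat.succ_eq_add_one, pow_succ a (r - k)]
      field_simp
    rw [Finset.sum_range_succ, Finset.sum_congr rfl e, ← Finset.mul_sum,
      eq_sub_of_add_eq ih, Nat.add_sub_cancel_left]
    field_simp
    ring

theorem sum_doubleZeta_eq_realZeta {r : ℕ} (hr : 1 ≤ r) :
    ∑ k ∈ Finset.range r, doubleZeta (k + 2) (r - k) = realZeta (r + 2) := by
  have hswap {k l : ℕ} (hk : 2 ≤ k) (hl : 1 ≤ l) :
      Summable fun q : ℕ+ × ℕ+ => 1 / (((q.1 : ℝ) + q.2) ^ k * (q.1 : ℝ) ^ l) := by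
    simpa only [Prod.fst_swap, Prod.snd_swap, add_comm] using (summable_doubleZeta hk hl).prod_symm
  have hterm : ∀ k ∈ Finset.range r, Summable fun q : ℕ+ × ℕ+ =>
      1 / (((q.1 : ℝ) + q.2) ^ (k + 2) * (q.1 : ℝ) ^ (r - k)) := fun k hk =>
    hswap (by lia) (Nat.sub_pos_of_lt (Finset.mem_range.1 hk))
  have h := tsum_tornheim_eq hr
  have hlast := summable_doubleZeta (show 2 ≤ r + 1 by lia) le_rfl
  simp only [pow_one] at hlast
  simp only [← sum_one_div_add_pow_mul_pow r (Nat.cast_pos.2 (PNat.pos _))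
    (Nat.cast_pos.2 (PNat.pos _))] at h
  rw [(summable_sum hterm).tsum_add hlast, Summable.tsum_finsetSum hterm] at h
  simpa only [tsum_swap_eq_doubleZeta, doubleZeta, pow_one, add_left_inj] using h

/-- Euler's evaluation, from the sum formula and the products `ζ(k + 2) ζ(n - 1 - k)`. -/
theorem two_mul_doubleZeta_one (r : ℕ) :
    2 * doubleZeta (r + 2) 1 = (r + 2) * realZeta (r + 3) -
      ∑ k ∈ Finset.range r, realZeta (k + 2) * realZeta (r + 1 - k) := by
  have hsum := sum_doubleZeta_eq_realZeta (show 1 ≤ r + 1 by lia)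
  have hrefl : ∑ k ∈ Finset.range r, doubleZeta (r + 1 - k) (k + 2) =
      ∑ k ∈ Finset.range r, doubleZeta (k + 2) (r + 1 - k) := by
    rw [← Finset.sum_range_reflect]
    refine Finset.sum_congr rfl fun k hk => ?_
    have := Finset.mem_range.1 hk
    congr 1 <;> lia
  have hmul : ∀ k ∈ Finset.range r, realZeta (k + 2) * realZeta (r + 1 - k) =
      doubleZeta (k + 2) (r + 1 - k) + doubleZeta (r + 1 - k) (k + 2) + realZeta (r + 3) := by
    intro k hk
    have := Finset.mem_range.1 hk
    rw [realZeta_mul_realZeta (by lia) (by lia), show k + 2 + (r + 1 - k) = r + 3 by lia]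
  rw [Finset.sum_range_succ, Nat.add_sub_cancel_left] at hsum
  rw [Finset.sum_congr rfl hmul, Finset.sum_add_distrib, Finset.sum_add_distrib, hrefl,
    eq_sub_of_add_eq hsum, Finset.sum_const, Finset.card_range, nsmul_eq_mul]
  ring

theorem realZeta_two : realZeta 2 = Real.pi ^ 2 / 6 :=
  (realZeta_eq_tsum_nat le_rfl).trans hasSum_zeta_two.tsum_eq

theorem realZeta_four : realZeta 4 = Real.pi ^ 4 / 90 :=
  (realZeta_eq_tsum_nat (by norm_num)).trans hasSum_zeta_four.tsum_eq

theorem bernoulli_six : bernoulli 6 = 1 / 42 := by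
  have h5 : bernoulli' 5 = 0 := bernoulli'_eq_zero_of_odd (by decide) (by norm_num)
  rw [bernoulli_eq_bernoulli'_of_ne_one (by norm_num), bernoulli'_def]
  norm_num [Finset.sum_range_succ, h5, Nat.choose]

theorem realZeta_six : realZeta 6 = Real.pi ^ 6 / 945 := by
  rw [realZeta_eq_tsum_nat (by norm_num), (hasSum_zeta_nat (k := 3) (by norm_num)).tsum_eq,
    bernoulli_six]
  norm_num [Nat.factorial]
  ring

theorem realZeta_two_mul_realZeta_four : realZeta 2 * realZeta 4 = 7 / 4 * realZeta 6 := by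
  rw [realZeta_two, realZeta_four, realZeta_six]
  ring

theorem realZeta_two_sq : realZeta 2 ^ 2 = 5 / 2 * realZeta 4 := by
  rw [realZeta_two, realZeta_four]
  ring

theorem doubleZeta_two_one : doubleZeta 2 1 = realZeta 3 := by
  have h := two_mul_doubleZeta_one 0
  norm_num at h
  linarith

theorem doubleZeta_three_one : doubleZeta 3 1 = realZeta 4 / 4 := by
  have h := two_mul_doubleZeta_one 1
  norm_num [Finset.sum_range_succ] at h
  linarith [realZeta_two_sq]

theorem doubleZeta_four_one : doubleZeta 4 1 = 2 * realZeta 5 - realZeta 2 * realZeta 3 := by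
  have h := two_mul_doubleZeta_one 2
  norm_num [Finset.sum_range_succ] at h
  linarith

theorem doubleZeta_five_one : doubleZeta 5 1 = 3 / 4 * realZeta 6 - realZeta 3 ^ 2 / 2 := by
  have h := two_mul_doubleZeta_one 3
  norm_num [Finset.sum_range_succ] at h
  linarith [realZeta_two_mul_realZeta_four]

end DoubleZeta

section RadialIntegral

variable {U : Set ℂ} {f g : ℂ → ℂ} {z : ℂ}

theorem ofReal_mul_mem (hU : StarConvex ℝ 0 U) (hz : z ∈ U) {t : ℝ} (ht : t ∈ Icc 0 1) :
    (t : ℂ) * z ∈ U := by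
  simpa using starConvex_zero_iff.1 hU hz ht.1 ht.2

theorem continuousOn_comp_ofReal_mul (hU : StarConvex ℝ 0 U) (hf : ContinuousOn f U)
    (hz : z ∈ U) : ContinuousOn (fun t : ℝ => f (t * z)) (Icc 0 1) :=
  hf.comp (by fun_prop) fun _ => ofReal_mul_mem hU hz

theorem hasDerivAt_ofReal_mul (z : ℂ) (t : ℝ) : HasDerivAt (fun t : ℝ => (t : ℂ) * z) z t := by
  simpa using (hasDerivAt_id t).ofReal_comp.mul_const z

theorem hasDerivAt_integral_mul_comp_ofReal_mul (hUo : IsOpen U) (hU : StarConvex ℝ 0 U)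
    (hf : DifferentiableOn ℂ f U) (hz : z ∈ U) :
    HasDerivAt (fun w => ∫ t in (0 : ℝ)..1, w * f (t * w)) (f z) z := by
  have hcompact : IsCompact (segment ℝ 0 z) := by
    rw [← convexHull_pair]
    exact (toFinite _).isCompact_convexHull ℝ
  obtain ⟨δ, hδ, hδU⟩ := hcompact.exists_thickening_subset_open hUo (hU.segment_subset hz)
  set V := Metric.thickening δ (segment ℝ 0 z)
  have hV : Convex ℝ V := (convex_segment 0 z).thickening δ
  have hVo : IsOpen V := Metric.isOpen_thickening
  have h0V : 0 ∈ V := Metric.self_subset_thickening hδ _ (left_mem_segment ..)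
  have hzV : z ∈ V := Metric.self_subset_thickening hδ _ (right_mem_segment ..)
  obtain ⟨P, hP⟩ := hV.exists_forall_hasDerivWithinAt (hf.mono hδU)
  have hP' : ∀ w ∈ V, HasDerivAt P (f w) w := fun w hw => (hP w hw).hasDerivAt (hVo.mem_nhds hw)
  have hint : ∀ w ∈ V, ∫ t in (0 : ℝ)..1, w * f (t * w) = P w - P 0 := by
    intro w hw
    have hcont : ContinuousOn (fun t : ℝ => w * f (t * w)) (Icc 0 1) := continuousOn_const.mul
      (continuousOn_comp_ofReal_mul (hV.starConvex h0V) (hf.mono hδU).continuousOn hw)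
    rw [integral_eq_sub_of_hasDerivAt (f := fun t : ℝ => P (t * w)) (fun t ht => ?_)
      (hcont.intervalIntegrable_of_Icc zero_le_one)]
    · simp
    · rw [uIcc_of_le zero_le_one] at ht
      have h := hP' _ (ofReal_mul_mem (hV.starConvex h0V) hw ht)
      exact (h.comp_of_eq t (hasDerivAt_ofReal_mul w t) rfl).congr_deriv (mul_comm _ _)
  refine ((hP' z hzV).sub_const (P 0)).congr_of_eventuallyEq ?_
  filter_upwards [hVo.mem_nhds hzV] with w hw using hint w hw

/-- The integral of `g(s) ds / s` along the segment from `0` to `z`. -/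
noncomputable def radialIntegral (g : ℂ → ℂ) (z : ℂ) : ℂ :=
  ∫ t in (0 : ℝ)..1, g (t * z) / t

theorem radialIntegral_zero (hg₀ : g 0 = 0) : radialIntegral g 0 = 0 := by
  simp [radialIntegral, hg₀]

theorem apply_ofReal_mul_div (hg₀ : g 0 = 0) (z : ℂ) {t : ℝ} (ht : t ≠ 0) :
    g (t * z) / t = z * dslope g 0 (t * z) := by
  have h := sub_smul_dslope g 0 (t * z)
  simp only [sub_zero, smul_eq_mul, hg₀] at h
  rw [← h]
  have : (t : ℂ) ≠ 0 := ofReal_ne_zero.2 ht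
  field_simp

theorem radialIntegral_eq_integral_dslope (hg₀ : g 0 = 0) (z : ℂ) :
    radialIntegral g z = ∫ t in (0 : ℝ)..1, z * dslope g 0 (t * z) := by
  refine integral_congr_ae (ae_of_all _ fun t ht => ?_)
  rw [uIoc_of_le zero_le_one] at ht
  exact apply_ofReal_mul_div hg₀ z ht.1.ne'

theorem differentiableOn_dslope_zero (hUo : IsOpen U) (hU : StarConvex ℝ 0 U)
    (hg : DifferentiableOn ℂ g U) : DifferentiableOn ℂ (dslope g 0) U := fun z hz =>
  (Complex.differentiableOn_dslope (hUo.mem_nhds (hU.mem ⟨z, hz⟩))).2 hg z hz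

theorem hasDerivAt_radialIntegral_dslope (hUo : IsOpen U) (hU : StarConvex ℝ 0 U)
    (hg : DifferentiableOn ℂ g U) (hg₀ : g 0 = 0) (hz : z ∈ U) :
    HasDerivAt (radialIntegral g) (dslope g 0 z) z := by
  rw [funext (radialIntegral_eq_integral_dslope hg₀)]
  exact hasDerivAt_integral_mul_comp_ofReal_mul hUo hU (differentiableOn_dslope_zero hUo hU hg) hz

theorem hasDerivAt_radialIntegral (hUo : IsOpen U) (hU : StarConvex ℝ 0 U)
    (hg : DifferentiableOn ℂ g U) (hg₀ : g 0 = 0) (hz : z ∈ U) (hz₀ : z ≠ 0) :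
    HasDerivAt (radialIntegral g) (g z / z) z := by
  refine (hasDerivAt_radialIntegral_dslope hUo hU hg hg₀ hz).congr_deriv ?_
  simp [dslope_of_ne g hz₀, slope_def_field, hg₀]

theorem differentiableOn_radialIntegral (hUo : IsOpen U) (hU : StarConvex ℝ 0 U)
    (hg : DifferentiableOn ℂ g U) (hg₀ : g 0 = 0) : DifferentiableOn ℂ (radialIntegral g) U :=
  fun _ hz => (hasDerivAt_radialIntegral_dslope hUo hU hg hg₀ hz).differentiableAt
    |>.differentiableWithinAt

theorem intervalIntegrable_log_pow (k : ℕ) :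
    IntervalIntegrable (fun t : ℝ => Real.log t ^ k) volume 0 1 := by
  rcases k.eq_zero_or_pos with rfl | hk
  · simp
  have hbound : IntervalIntegrable (fun t : ℝ => (2 * k : ℝ) ^ k * t ^ (-(1 / 2) : ℝ)) volume 0 1 :=
    (intervalIntegrable_rpow' (by norm_num)).const_mul _
  refine hbound.mono_fun (Real.measurable_log.pow_const k).aestronglyMeasurable ?_
  refine (ae_restrict_iff' measurableSet_uIoc).2 (ae_of_all _ fun t ht => ?_)
  rw [uIoc_of_le zero_le_one] at ht
  have hpos : 0 < t ^ (1 / 2 : ℝ) := Real.rpow_pos_of_pos ht.1 _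
  have hroot : (t ^ (1 / (2 * k) : ℝ)) ^ k = t ^ (1 / 2 : ℝ) := by
    rw [← Real.rpow_mul_natCast ht.1.le]
    congr 1
    field_simp
  have hlog : |Real.log t| ^ k * t ^ (1 / 2 : ℝ) ≤ (2 * k) ^ k := by
    have h := (Real.abs_log_mul_self_rpow_lt t (1 / (2 * k)) ht.1 ht.2 (by positivity)).le
    rw [abs_mul, abs_of_pos (Real.rpow_pos_of_pos ht.1 _), one_div_one_div] at h
    simpa only [mul_pow, hroot] using pow_le_pow_left₀
      (mul_nonneg (abs_nonneg _) (Real.rpow_nonneg ht.1.le _)) h k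
  simp only
  rw [norm_pow, Real.norm_eq_abs, Real.norm_of_nonneg (by have := ht.1; positivity),
    Real.rpow_neg ht.1.le, ← div_eq_mul_inv, le_div_iff₀ hpos]
  exact hlog

theorem intervalIntegrable_log_pow_mul_div (hUo : IsOpen U) (hU : StarConvex ℝ 0 U)
    (hg : DifferentiableOn ℂ g U) (hg₀ : g 0 = 0) (hz : z ∈ U) (k : ℕ) :
    IntervalIntegrable (fun t : ℝ => (Real.log t : ℂ) ^ k * g (t * z) / t) volume 0 1 := by
  have hlog : IntervalIntegrable (fun t : ℝ => (Real.log t : ℂ) ^ k) volume 0 1 := by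
    have h := intervalIntegrable_log_pow k
    rw [intervalIntegrable_iff] at h ⊢
    simpa [IntegrableOn] using h.ofReal (𝕜 := ℂ)
  have hcont : ContinuousOn (fun t : ℝ => z * dslope g 0 (t * z)) (uIcc 0 1) := by
    rw [uIcc_of_le zero_le_one]
    exact continuousOn_const.mul
      (continuousOn_comp_ofReal_mul hU (differentiableOn_dslope_zero hUo hU hg).continuousOn hz)
  refine (hlog.mul_continuousOn hcont).congr fun t ht => ?_
  rw [uIoc_of_le zero_le_one] at ht
  simp only [← apply_ofReal_mul_div hg₀ z ht.1.ne', mul_div_assoc]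

theorem tendsto_log_pow_mul_self (k : ℕ) :
    Tendsto (fun t : ℝ => Real.log t ^ k * t) (𝓝[>] 0) (𝓝 0) := by
  rcases k.eq_zero_or_pos with rfl | hk
  · simpa using! tendsto_nhdsWithin_of_tendsto_nhds (tendsto_id (x := 𝓝 (0 : ℝ)))
  have h := (tendsto_log_mul_rpow_nhdsGT_zero (r := 1 / k) (by positivity)).pow k
  rw [zero_pow hk.ne'] at h
  refine h.congr' ?_
  filter_upwards [self_mem_nhdsWithin] with t ht
  rw [mul_pow, ← Real.rpow_mul_natCast (mem_Ioi.1 ht).le, one_div_mul_cancel (by positivity),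
    Real.rpow_one]

theorem tendsto_log_pow_mul (hg : DifferentiableAt ℂ g 0) (hg₀ : g 0 = 0) (z : ℂ) (k : ℕ) :
    Tendsto (fun t : ℝ => (Real.log t : ℂ) ^ k * g (t * z)) (𝓝[>] 0) (𝓝 0) := by
  have hdslope : Tendsto (fun t : ℝ => dslope g 0 (t * z)) (𝓝[>] 0) (𝓝 (dslope g 0 0)) := by
    have h : Tendsto (fun t : ℝ => (t : ℂ) * z) (𝓝 0) (𝓝 0) := by
      simpa using! (by fun_prop : Continuous fun t : ℝ => (t : ℂ) * z).tendsto 0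
    exact ((continuousAt_dslope_same.2 hg).tendsto.comp h).mono_left nhdsWithin_le_nhds
  have hlog : Tendsto (fun t : ℝ => ((Real.log t ^ k * t : ℝ) : ℂ)) (𝓝[>] 0) (𝓝 0) := by
    rw [← ofReal_zero]
    exact (continuous_ofReal.tendsto 0).comp (tendsto_log_pow_mul_self k)
  have hmul := hlog.mul (hdslope.const_mul z)
  rw [zero_mul] at hmul
  refine hmul.congr' ?_
  filter_upwards [self_mem_nhdsWithin] with t (ht : 0 < t)
  have ht₀ : (t : ℂ) ≠ 0 := ofReal_ne_zero.2 ht.ne'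
  rw [← apply_ofReal_mul_div hg₀ z ht.ne']
  push_cast
  field_simp

theorem hasDerivAt_log_pow_succ_mul_radialIntegral (hUo : IsOpen U) (hU : StarConvex ℝ 0 U)
    (hg : DifferentiableOn ℂ g U) (hg₀ : g 0 = 0) (hz : z ∈ U) (k : ℕ) {t : ℝ}
    (ht : t ∈ Ioc 0 1) :
    HasDerivAt (fun t : ℝ => (Real.log t : ℂ) ^ (k + 1) * radialIntegral g (t * z))
      ((k + 1) * ((Real.log t : ℂ) ^ k * radialIntegral g (t * z) / t) +
        (Real.log t : ℂ) ^ (k + 1) * g (t * z) / t) t := by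
  have hlog := (Real.hasDerivAt_log ht.1.ne').ofReal_comp.fun_pow (k + 1)
  have hG := (hasDerivAt_radialIntegral_dslope hUo hU hg hg₀
    (ofReal_mul_mem hU hz (Ioc_subset_Icc_self ht))).comp_of_eq t (hasDerivAt_ofReal_mul z t) rfl
  refine (hlog.mul hG).congr_deriv ?_
  rw [mul_comm (dslope g 0 _) z, ← apply_ofReal_mul_div hg₀ z ht.1.ne']
  push_cast
  simp only [Function.comp_apply]
  ring

theorem integral_log_pow_succ_mul_div (hUo : IsOpen U) (hU : StarConvex ℝ 0 U)
    (hg : DifferentiableOn ℂ g U) (hg₀ : g 0 = 0) (hz : z ∈ U) (k : ℕ) :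
    ∫ t in (0 : ℝ)..1, (Real.log t : ℂ) ^ (k + 1) * g (t * z) / t =
      -(k + 1) * ∫ t in (0 : ℝ)..1, (Real.log t : ℂ) ^ k * radialIntegral g (t * z) / t := by
  have hG := differentiableOn_radialIntegral hUo hU hg hg₀
  have hG₀ := radialIntegral_zero hg₀
  have hint := intervalIntegrable_log_pow_mul_div hUo hU hg hg₀ hz (k + 1)
  have hintG := (intervalIntegrable_log_pow_mul_div hUo hU hG hG₀ hz k).const_mul ((k : ℂ) + 1)
  have hderiv := @hasDerivAt_log_pow_succ_mul_radialIntegral U g z hUo hU hg hg₀ hz k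
  have hlim₀ : Tendsto (fun t : ℝ => (Real.log t : ℂ) ^ (k + 1) * radialIntegral g (t * z))
      (𝓝[>] 0) (𝓝 0) :=
    tendsto_log_pow_mul (hG.differentiableAt (hUo.mem_nhds (hU.mem ⟨z, hz⟩))) hG₀ z (k + 1)
  have hlim₁ : Tendsto (fun t : ℝ => (Real.log t : ℂ) ^ (k + 1) * radialIntegral g (t * z))
      (𝓝[<] 1) (𝓝 0) := by
    simpa using (hderiv (t := 1) (by simp)).continuousAt.tendsto.mono_left
      (nhdsWithin_le_nhds (s := Iio 1))
  have key := integral_eq_sub_of_hasDerivAt_of_tendsto zero_lt_one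
    (fun t ht => hderiv (Ioo_subset_Ioc_self ht)) (hintG.add hint) hlim₀ hlim₁
  rw [integral_add hintG hint, intervalIntegral.integral_const_mul, sub_zero] at key
  linear_combination key

end RadialIntegral

section NielsenPolylog

variable {z : ℂ} {p : ℕ}

/-- The plane cut along `[1, ∞)`, the domain of the polylogarithms. -/
def cutPlane : Set ℂ := {z | 1 - z ∈ slitPlane}

theorem isOpen_cutPlane : IsOpen cutPlane :=
  isOpen_slitPlane.preimage (by fun_prop : Continuous fun z : ℂ => 1 - z)

theorem starConvex_cutPlane : StarConvex ℝ 0 cutPlane := by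
  refine starConvex_zero_iff.2 fun z hz t h₀ h₁ => ?_
  have h := starConvex_one_slitPlane hz (sub_nonneg.2 h₁) h₀ (by ring)
  have hcomb : 1 - t • z = (1 - t) • (1 : ℂ) + t • (1 - z) := by module
  rwa [← hcomb] at h

theorem cutPlane_mem_nhds_zero : cutPlane ∈ 𝓝 0 :=
  isOpen_cutPlane.mem_nhds (by simp [cutPlane])

theorem hasDerivAt_log_one_sub (hz : z ∈ cutPlane) :
    HasDerivAt (fun z => log (1 - z)) (-(1 - z)⁻¹) z := by
  simpa [neg_div] using ((hasDerivAt_id z).const_sub 1).clog hz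

/-- The iterated integrals `∫ ⋯ ∫ (-log (1 - s))ᵖ / p! · ds/s ⋯ ds/s` along the segment from `0` to
`z`, with `n` integrations. Nielsen's `S_{n,p}` is the case `1 ≤ n`, and `Li_{n+1}` the case
`p = 1`. -/
noncomputable def nielsenIter : ℕ → ℕ → ℂ → ℂ
  | 0, p, z => (-log (1 - z)) ^ p / (p ! : ℂ)
  | n + 1, p, z => radialIntegral (nielsenIter n p) z

theorem nielsenIter_zero (p : ℕ) (z : ℂ) : nielsenIter 0 p z = (-log (1 - z)) ^ p / (p ! : ℂ) :=
  rfl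

theorem nielsenIter_succ (n p : ℕ) : nielsenIter (n + 1) p = radialIntegral (nielsenIter n p) :=
  rfl

theorem nielsenIter_apply_zero (hp : p ≠ 0) (n : ℕ) : nielsenIter n p 0 = 0 := by
  induction n with
  | zero => simp [nielsenIter, hp]
  | succ n ih => exact radialIntegral_zero ih

theorem differentiableOn_nielsenIter (hp : p ≠ 0) (n : ℕ) :
    DifferentiableOn ℂ (nielsenIter n p) cutPlane := by
  induction n with
  | zero => exact fun z hz => ((hasDerivAt_log_one_sub hz).fun_neg.fun_pow p
      |>.div_const _).differentiableAt.differentiableWithinAt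
  | succ n ih =>
    exact differentiableOn_radialIntegral isOpen_cutPlane starConvex_cutPlane ih
      (nielsenIter_apply_zero hp n)

theorem differentiableAt_nielsenIter_zero (hp : p ≠ 0) (n : ℕ) :
    DifferentiableAt ℂ (nielsenIter n p) 0 :=
  (differentiableOn_nielsenIter hp n).differentiableAt cutPlane_mem_nhds_zero

theorem hasDerivAt_nielsenIter_zero_succ (p : ℕ) (hz : z ∈ cutPlane) :
    HasDerivAt (nielsenIter 0 (p + 1)) (nielsenIter 0 p z * (1 - z)⁻¹) z := by
  simpa only [neg_neg, ← nielsenIter_zero] using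
    hasDerivAt_pow_succ_div_factorial (hasDerivAt_log_one_sub hz).fun_neg p

theorem hasDerivAt_nielsenIter_succ (hp : p ≠ 0) (n : ℕ) (hz : z ∈ cutPlane) (hz₀ : z ≠ 0) :
    HasDerivAt (nielsenIter (n + 1) p) (nielsenIter n p z / z) z :=
  hasDerivAt_radialIntegral isOpen_cutPlane starConvex_cutPlane
    (differentiableOn_nielsenIter hp n) (nielsenIter_apply_zero hp n) hz hz₀

theorem classicalPolylog_succ_eq_nielsenIter (m : ℕ) :
    classicalPolylog (m + 1) = nielsenIter m 1 := by
  induction m with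
  | zero => funext z; simp [classicalPolylog, nielsenIter]
  | succ m ih => funext z; simp [classicalPolylog, nielsenIter, radialIntegral, ih]

theorem integral_log_pow_mul_nielsenIter_div (hp : p ≠ 0) (n k : ℕ) (hz : z ∈ cutPlane) :
    ∫ t in (0 : ℝ)..1, (Real.log t : ℂ) ^ k * nielsenIter n p (t * z) / t =
      (-1) ^ k * (k ! : ℂ) * nielsenIter (n + k + 1) p z := by
  induction k generalizing n with
  | zero => simp [nielsenIter, radialIntegral]
  | succ k ih =>
    rw [integral_log_pow_succ_mul_div isOpen_cutPlane starConvex_cutPlane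
      (differentiableOn_nielsenIter hp n) (nielsenIter_apply_zero hp n) hz, ← nielsenIter_succ, ih,
      Nat.factorial_succ, show n + 1 + k + 1 = n + (k + 1) + 1 by ring]
    push_cast
    ring

theorem nielsenPolylog_succ_eq_nielsenIter (hp : p ≠ 0) (n : ℕ) (hz : z ∈ cutPlane) :
    nielsenPolylog (n + 1) p z = nielsenIter (n + 1) p z := by
  have hn : (n ! : ℂ) ≠ 0 := Nat.cast_ne_zero.2 n.factorial_ne_zero
  have hp' : (p ! : ℂ) ≠ 0 := Nat.cast_ne_zero.2 p.factorial_ne_zero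
  have hlog : ∀ t : ℝ, (Real.log t : ℂ) ^ n * log (1 - z * t) ^ p / t =
      (-1) ^ p * (p ! : ℂ) * ((Real.log t : ℂ) ^ n * nielsenIter 0 p (t * z) / t) := by
    intro t
    rw [nielsenIter_zero, ← neg_neg (log (1 - z * t)), neg_pow (-log _), mul_comm z]
    field_simp
  have hsign : (-1 : ℂ) ^ (n + p) * ((-1) ^ p * (-1) ^ n) = 1 := by
    rw [← pow_add, ← pow_add, add_comm p n]
    exact Even.neg_one_pow ⟨_, rfl⟩
  have hintegral := integral_log_pow_mul_nielsenIter_div hp 0 n hz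
  rw [nielsenPolylog, Nat.add_sub_cancel, add_right_comm, Nat.add_sub_cancel]
  simp only [hlog, intervalIntegral.integral_const_mul, hintegral, zero_add]
  field_simp
  linear_combination nielsenIter (n + 1) p z * hsign

end NielsenPolylog

section PowerSeries

variable {ι : Type*} {g : ℂ → ℂ} {c : ι → ℂ} {e : ι → ℕ+} {z : ℂ}

theorem integral_mul_ofReal_mul_pow_div (c z : ℂ) (k : ℕ+) :
    ∫ t in (0 : ℝ)..1, c * (t * z) ^ (k : ℕ) / t = c / k * z ^ (k : ℕ) := by
  obtain ⟨m, rfl⟩ : ∃ m : ℕ, k = m.succPNat := ⟨k.natPred, k.succPNat_natPred.symm⟩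
  have hpow : ∫ t in (0 : ℝ)..1, (t : ℂ) ^ m = 1 / (m + 1) := by
    simp only [← ofReal_pow, intervalIntegral.integral_ofReal, integral_pow]
    simp
  have hcongr : ∫ t in (0 : ℝ)..1, c * (t * z) ^ (m + 1) / t =
      ∫ t in (0 : ℝ)..1, c * z ^ (m + 1) * (t : ℂ) ^ m := by
    refine integral_congr_ae (ae_of_all _ fun t ht => ?_)
    rw [uIoc_of_le zero_le_one] at ht
    have ht₀ : (t : ℂ) ≠ 0 := ofReal_ne_zero.2 ht.1.ne'
    rw [mul_pow, pow_succ (t : ℂ)]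
    field_simp
  rw [Nat.succPNat_coe, Nat.succ_eq_add_one, hcongr, intervalIntegral.integral_const_mul, hpow]
  push_cast
  ring

theorem hasSum_radialIntegral [Countable ι]
    (hg : ∀ w : ℂ, ‖w‖ < 1 → HasSum (fun i => c i * w ^ (e i : ℕ)) (g w)) (hz : ‖z‖ < 1) :
    HasSum (fun i => c i / e i * z ^ (e i : ℕ)) (radialIntegral g z) := by
  simp only [← integral_mul_ofReal_mul_pow_div]
  refine intervalIntegral.hasSum_integral_of_dominated_convergence
    (bound := fun i _ => ‖c i * z ^ (e i : ℕ)‖) (fun i => ?_) (fun i => ?_) ?_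
    intervalIntegrable_const ?_
  · exact (by fun_prop : Measurable fun t : ℝ => c i * (t * z) ^ (e i : ℕ) / t).aestronglyMeasurable
  · refine ae_of_all _ fun t ht => ?_
    rw [uIoc_of_le zero_le_one] at ht
    rw [mul_pow, mul_left_comm, mul_div_right_comm, norm_mul]
    refine mul_le_of_le_one_left (norm_nonneg _) ?_
    rw [norm_div, norm_pow, norm_real, Real.norm_of_nonneg ht.1.le]
    exact div_le_one_of_le₀ (pow_le_of_le_one ht.1.le ht.2 (e i).ne_zero) ht.1.le
  · exact ae_of_all _ fun t _ => (hg z hz).summable.norm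
  · refine ae_of_all _ fun t ht => (hg _ ?_).div_const (t : ℂ)
    rw [uIoc_of_le zero_le_one] at ht
    rw [norm_mul, norm_real, Real.norm_of_nonneg ht.1.le]
    exact (mul_le_of_le_one_left (norm_nonneg z) ht.2).trans_lt hz

theorem hasSum_pow_div_pnat (hz : ‖z‖ < 1) :
    HasSum (fun k : ℕ+ => z ^ (k : ℕ) / k) (-log (1 - z)) := by
  refine (Equiv.pnatEquivNat.hasSum_iff.2 (hasSum_taylorSeries_neg_log' hz)).congr_fun fun k => ?_
  rw [Function.comp_apply, Equiv.pnatEquivNat_apply, ← Nat.cast_add_one, PNat.natPred_add_one]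

theorem hasSum_nielsenIter_one (n : ℕ) (hz : ‖z‖ < 1) :
    HasSum (fun k : ℕ+ => 1 / (k : ℂ) ^ (n + 1) * z ^ (k : ℕ)) (nielsenIter n 1 z) := by
  induction n generalizing z with
  | zero => simpa [nielsenIter, div_eq_mul_inv, mul_comm] using hasSum_pow_div_pnat hz
  | succ n ih =>
    simpa only [id_eq, div_div, ← pow_succ] using!
      hasSum_radialIntegral (e := id) (fun w hw => ih hw) hz

theorem hasSum_sq_div_two {ι : Type*} {u : ι → ℂ} {s : ℂ} (hu : HasSum u s) {F : ι × ι → ℂ}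
    (hF : Summable F) (huF : ∀ i j, u i * u j = F (i, j) + F (j, i)) : HasSum F (s ^ 2 / 2) := by
  have hprod := hu.mul hu (summable_mul_of_summable_norm hu.summable.norm hu.summable.norm)
  have hswap : HasSum (fun q : ι × ι => F q.swap) (∑' q, F q) :=
    (Equiv.prodComm ι ι).hasSum_iff.2 hF.hasSum
  have hsum := (hprod.congr_fun fun q => (huF q.1 q.2).symm).unique (hF.hasSum.add hswap)
  rw [show s ^ 2 / 2 = ∑' q, F q by linear_combination hsum / 2]
  exact hF.hasSum

theorem summable_pow_add_div (hz : ‖z‖ < 1) :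
    Summable fun q : ℕ+ × ℕ+ => 1 / (((q.1 : ℂ) + q.2) * q.2) * z ^ ((q.1 + q.2 : ℕ+) : ℕ) := by
  have hgeom : Summable fun k : ℕ+ => ‖z‖ ^ (k : ℕ) :=
    (summable_geometric_of_lt_one (norm_nonneg z) hz).comp_injective PNat.coe_injective
  refine Summable.of_norm_bounded (summable_mul_of_summable_norm hgeom.norm hgeom.norm) fun q => ?_
  have hden : (1 : ℝ) ≤ (q.1 + q.2) * q.2 := by
    nlinarith [one_le_pnat_cast q.1, one_le_pnat_cast q.2]
  have hcoeff : ‖1 / (((q.1 : ℂ) + q.2) * q.2)‖ ≤ 1 := by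
    rw [norm_div, norm_one]
    refine div_le_one_of_le₀ ?_ (norm_nonneg _)
    rw [show ((q.1 : ℂ) + q.2) * q.2 = (((q.1 + q.2) * q.2 : ℝ) : ℂ) by push_cast; rfl, norm_real]
    exact hden.trans (Real.le_norm_self _)
  rw [norm_mul, norm_pow, ← pow_add, PNat.add_coe]
  exact mul_le_of_le_one_left (by positivity) hcoeff

theorem hasSum_sq_log_one_sub_div_two (hz : ‖z‖ < 1) :
    HasSum (fun q : ℕ+ × ℕ+ => 1 / (((q.1 : ℂ) + q.2) * q.2) * z ^ ((q.1 + q.2 : ℕ+) : ℕ))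
      ((-log (1 - z)) ^ 2 / 2) := by
  refine hasSum_sq_div_two (hasSum_pow_div_pnat hz) (summable_pow_add_div hz) fun i j => ?_
  have hi : (i : ℂ) ≠ 0 := Nat.cast_ne_zero.2 i.ne_zero
  have hj : (j : ℂ) ≠ 0 := Nat.cast_ne_zero.2 j.ne_zero
  have hij : (i : ℂ) + j ≠ 0 := by exact_mod_cast (i + j).ne_zero
  simp only [PNat.add_coe, pow_add]
  rw [add_comm (j : ℂ)]
  field_simp

theorem hasSum_nielsenIter_two (n : ℕ) (hz : ‖z‖ < 1) :
    HasSum (fun q : ℕ+ × ℕ+ => 1 / (((q.1 : ℂ) + q.2) ^ (n + 1) * q.2) *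
      z ^ ((q.1 + q.2 : ℕ+) : ℕ)) (nielsenIter n 2 z) := by
  induction n generalizing z with
  | zero => simpa [nielsenIter] using hasSum_sq_log_one_sub_div_two hz
  | succ n ih =>
    refine (hasSum_radialIntegral (fun w hw => ih hw) hz).congr_fun fun q => ?_
    rw [div_div, pow_succ _ (n + 1), PNat.add_coe, Nat.cast_add, mul_right_comm]

theorem tendsto_apply_one_sub (hc : Summable fun i => ‖c i‖)
    (hg : ∀ w : ℂ, ‖w‖ < 1 → HasSum (fun i => c i * w ^ (e i : ℕ)) (g w)) :
    Tendsto (fun x : ℝ => g (1 - x)) (𝓝[>] 0) (𝓝 (∑' i, c i)) := by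
  have hball : ∀ᶠ x : ℝ in 𝓝[>] 0, ‖(1 : ℂ) - x‖ < 1 := by
    filter_upwards [Ioo_mem_nhdsGT (zero_lt_one' ℝ)] with x hx
    rw [← ofReal_one, ← ofReal_sub, norm_real, Real.norm_of_nonneg (by linarith [hx.2])]
    linarith [hx.1]
  have hseries : Tendsto (fun x : ℝ => ∑' i, c i * ((1 : ℂ) - x) ^ (e i : ℕ)) (𝓝[>] 0)
      (𝓝 (∑' i, c i)) := by
    refine tendsto_tsum_of_dominated_convergence hc (fun i => ?_) ?_
    · have hcont : Continuous fun x : ℝ => c i * ((1 : ℂ) - x) ^ (e i : ℕ) := by fun_prop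
      simpa using (hcont.tendsto 0).mono_left nhdsWithin_le_nhds
    · filter_upwards [hball] with x hx i
      rw [norm_mul, norm_pow]
      exact mul_le_of_le_one_right (norm_nonneg _) (pow_le_one₀ (norm_nonneg _) hx.le)
  refine hseries.congr' ?_
  filter_upwards [hball] with x hx using (hg _ hx).tsum_eq

theorem tendsto_nielsenIter_one_one_sub (n : ℕ) :
    Tendsto (fun x : ℝ => nielsenIter (n + 1) 1 (1 - x)) (𝓝[>] 0) (𝓝 (realZeta (n + 2))) := by
  rw [realZeta, ofReal_tsum]
  refine tendsto_apply_one_sub (e := id) ?_ fun w hw => ?_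
  · simpa only [norm_real] using (summable_one_div_pnat_pow (k := n + 2) (by lia)).norm
  · simpa using hasSum_nielsenIter_one (n + 1) hw

theorem tendsto_nielsenIter_two_one_sub (n : ℕ) :
    Tendsto (fun x : ℝ => nielsenIter (n + 1) 2 (1 - x)) (𝓝[>] 0) (𝓝 (doubleZeta (n + 2) 1)) := by
  rw [doubleZeta, ofReal_tsum]
  refine tendsto_apply_one_sub (e := fun q => q.1 + q.2) ?_ fun w hw => ?_
  · simpa only [norm_real] using (summable_doubleZeta (k := n + 2) (by lia) le_rfl).norm
  · simpa using hasSum_nielsenIter_two (n + 1) hw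

end PowerSeries

section FunctionalEquations

variable {z : ℂ}

/-- The plane cut along `(-∞, 0]` and `[1, ∞)`, on which `log z` and all the arguments `z`, `1 - z`
and `z / (z - 1)` of the polylogarithms avoid the cuts. -/
def doublyCutPlane : Set ℂ := slitPlane ∩ cutPlane

theorem isOpen_doublyCutPlane : IsOpen doublyCutPlane :=
  isOpen_slitPlane.inter isOpen_cutPlane

theorem ofReal_mem_doublyCutPlane {x : ℝ} (hx : x ∈ Ioo 0 1) : (x : ℂ) ∈ doublyCutPlane :=
  ⟨Or.inl (by simpa using hx.1), Or.inl (by simpa using hx.2)⟩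

theorem isPreconnected_doublyCutPlane : IsPreconnected doublyCutPlane := by
  have hstar : StarConvex ℝ ((1 / 2 : ℝ) : ℂ) doublyCutPlane := by
    refine (starConvex_ofReal_slitPlane (by norm_num)).inter fun w hw s t hs ht hst => ?_
    have h := starConvex_ofReal_slitPlane (x := 1 / 2) (by norm_num) hw hs ht hst
    have hst' : (s : ℂ) + t = 1 := by exact_mod_cast hst
    have hcomb : 1 - (s • ((1 / 2 : ℝ) : ℂ) + t • w) =
        s • ((1 / 2 : ℝ) : ℂ) + t • (1 - w) := by
      simp only [real_smul]
      push_cast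
      linear_combination -hst'
    rwa [← hcomb] at h
  have hmem : ((1 / 2 : ℝ) : ℂ) ∈ doublyCutPlane := ofReal_mem_doublyCutPlane (by norm_num)
  exact (hstar.isPathConnected hmem).isConnected.isPreconnected

theorem one_sub_mem_doublyCutPlane (hz : z ∈ doublyCutPlane) : 1 - z ∈ doublyCutPlane :=
  ⟨hz.2, by simpa [cutPlane] using hz.1⟩

theorem mem_doublyCutPlane_of_notMem
    (hz : z ∉ (fun x : ℝ => (x : ℂ)) '' (Iic 0 ∪ Ici 1)) : z ∈ doublyCutPlane := by
  have hreal : ∀ x ∈ Iic (0 : ℝ) ∪ Ici 1, z ≠ x := fun x hx h => hz ⟨x, hx, h.symm⟩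
  refine ⟨mem_slitPlane_iff_not_le_zero.2 fun h => ?_, mem_slitPlane_iff_not_le_zero.2 fun h => ?_⟩
  · exact hreal z.re (Or.inl h.1) (Complex.ext rfl h.2)
  · exact hreal z.re (Or.inr (by simpa using h.1)) (Complex.ext rfl (by simpa using h.2))

theorem one_sub_div_sub_one (hz : z ≠ 1) : 1 - z / (z - 1) = (1 - z)⁻¹ := by
  have h₁ : z - 1 ≠ 0 := sub_ne_zero.2 hz
  have h₂ : 1 - z ≠ 0 := sub_ne_zero.2 hz.symm
  field_simp
  ring

theorem ne_one_of_mem_cutPlane (hz : z ∈ cutPlane) : z ≠ 1 :=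
  (sub_ne_zero.1 (slitPlane_ne_zero hz)).symm

theorem div_sub_one_mem_cutPlane (hz : z ∈ cutPlane) : z / (z - 1) ∈ cutPlane := by
  have harg : arg (1 - z) ≠ Real.pi := slitPlane_arg_ne_pi hz
  have harg' : -arg (1 - z) ≠ Real.pi := (neg_lt.1 (neg_pi_lt_arg (1 - z))).ne
  rw [cutPlane, mem_ofPred_eq, one_sub_div_sub_one (ne_one_of_mem_cutPlane hz),
    mem_slitPlane_iff_arg, arg_inv, if_neg harg]
  exact ⟨harg', inv_ne_zero (slitPlane_ne_zero hz)⟩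

theorem log_one_sub_div_sub_one (hz : z ∈ cutPlane) :
    log (1 - z / (z - 1)) = -log (1 - z) := by
  rw [one_sub_div_sub_one (ne_one_of_mem_cutPlane hz), log_inv _ (slitPlane_arg_ne_pi hz)]

theorem eqOn_of_hasDerivAt_of_tendsto {𝕜 : Type*} [RCLike 𝕜] {U : Set 𝕜} {f g f' : 𝕜 → 𝕜}
    {ι : Type*} {l : Filter ι} [NeBot l] {u : ι → 𝕜} {c : 𝕜} (hUo : IsOpen U)
    (hU : IsPreconnected U) (hf : ∀ z ∈ U, HasDerivAt f (f' z) z)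
    (hg : ∀ z ∈ U, HasDerivAt g (f' z) z) (hu : ∀ᶠ i in l, u i ∈ U)
    (hfc : Tendsto (fun i => f (u i)) l (𝓝 c)) (hgc : Tendsto (fun i => g (u i)) l (𝓝 c)) :
    EqOn f g U := by
  obtain ⟨a, ha⟩ := hUo.exists_eq_add_of_deriv_eq hU
    (fun z hz => (hf z hz).differentiableAt.differentiableWithinAt)
    (fun z hz => (hg z hz).differentiableAt.differentiableWithinAt)
    (fun z hz => (hf z hz).deriv.trans (hg z hz).deriv.symm)
  have hfa : Tendsto (fun i => f (u i)) l (𝓝 (c + a)) :=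
    (hgc.add_const a).congr' (hu.mono fun i hi => (ha hi).symm)
  have ha₀ : a = 0 := by simpa using tendsto_nhds_unique hfa hfc
  intro z hz
  simpa [ha₀] using ha hz

theorem eventually_ofReal_mem_doublyCutPlane :
    ∀ᶠ x : ℝ in 𝓝[>] 0, (x : ℂ) ∈ doublyCutPlane := by
  filter_upwards [Ioo_mem_nhdsGT (zero_lt_one' ℝ)] with x hx using ofReal_mem_doublyCutPlane hx

theorem tendsto_ofReal_nhdsGT_zero : Tendsto (fun x : ℝ => (x : ℂ)) (𝓝[>] 0) (𝓝 0) := by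
  simpa using! (continuous_ofReal.tendsto 0).mono_left nhdsWithin_le_nhds

theorem tendsto_log_one_sub_nhdsGT_zero :
    Tendsto (fun x : ℝ => log (1 - (x : ℂ))) (𝓝[>] 0) (𝓝 0) := by
  have h := (hasDerivAt_log_one_sub (mem_of_mem_nhds cutPlane_mem_nhds_zero)).continuousAt.tendsto
  rw [sub_zero, log_one] at h
  exact h.comp tendsto_ofReal_nhdsGT_zero

theorem tendsto_nielsenIter_comp {p : ℕ} (hp : p ≠ 0) (n : ℕ) {ι : Type*} {l : Filter ι} {u : ι → ℂ}
    (hu : Tendsto u l (𝓝 0)) : Tendsto (fun i => nielsenIter n p (u i)) l (𝓝 0) := by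
  have h := (differentiableAt_nielsenIter_zero hp n).continuousAt.tendsto
  rw [nielsenIter_apply_zero hp] at h
  exact h.comp hu

theorem tendsto_neg_log_pow_div_factorial_mul_nielsenIter {p : ℕ} (hp : p ≠ 0) (n k : ℕ) :
    Tendsto (fun x : ℝ => (-log (x : ℂ)) ^ k / (k ! : ℂ) * nielsenIter n p x) (𝓝[>] 0) (𝓝 0) := by
  have h := (tendsto_log_pow_mul (differentiableAt_nielsenIter_zero hp n)
    (nielsenIter_apply_zero hp n) 1 k).const_mul ((-1) ^ k / (k ! : ℂ))
  rw [mul_zero] at h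
  refine h.congr' ?_
  filter_upwards [self_mem_nhdsWithin] with x hx
  rw [mul_one, ofReal_log (mem_Ioi.1 hx).le, neg_pow (log _)]
  ring

/-- The sum `∑ (-log z)ⁱ / i! · S_{p+1-i, n+1}(z)` over `i ≤ p`, whose derivative is elementary. -/
noncomputable def reflectionSum (n p : ℕ) (z : ℂ) : ℂ :=
  expConv (-log z) (fun m => nielsenIter (m + 1) (n + 1) z) p

theorem hasDerivAt_reflectionSum (n p : ℕ) (hz : z ∈ doublyCutPlane) :
    HasDerivAt (reflectionSum n p)
      ((-log z) ^ p / (p ! : ℂ) * ((-log (1 - z)) ^ (n + 1) / ((n + 1)! : ℂ) / z)) z := by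
  have hderiv (m : ℕ) := hasDerivAt_nielsenIter_succ n.succ_ne_zero m hz.2 (slitPlane_ne_zero hz.1)
  refine hasDerivAt_expConv_of_forall_eq_neg_mul (U := fun m => nielsenIter (m + 1) (n + 1))
    (hasDerivAt_log hz.1).fun_neg (hderiv 0) (fun m => (hderiv (m + 1)).congr_deriv ?_) p
  ring

theorem tendsto_reflectionSum (n p : ℕ) :
    Tendsto (fun x : ℝ => reflectionSum n p x) (𝓝[>] 0) (𝓝 0) := by
  simpa [reflectionSum, expConv] using tendsto_finsetSum (Finset.range (p + 1)) fun j _ =>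
    tendsto_neg_log_pow_div_factorial_mul_nielsenIter n.succ_ne_zero (p - j + 1) j

theorem tendsto_reflectionSum_one_sub {p : ℕ} {s : ℕ → ℂ}
    (hs : ∀ m, Tendsto (fun x : ℝ => nielsenIter (m + 1) (p + 1) (1 - x)) (𝓝[>] 0) (𝓝 (s m)))
    (n : ℕ) : Tendsto (fun x : ℝ => reflectionSum p n (1 - x)) (𝓝[>] 0) (𝓝 (s n)) := by
  have h := tendsto_expConv (a := fun m (x : ℝ) => nielsenIter (m + 1) (p + 1) (1 - x))
    tendsto_log_one_sub_nhdsGT_zero.neg hs n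
  rwa [neg_zero, expConv_zero] at h

theorem reflectionSum_one_sub_add_reflectionSum {p : ℕ} {s : ℕ → ℂ}
    (hs : ∀ m, Tendsto (fun x : ℝ => nielsenIter (m + 1) (p + 1) (1 - x)) (𝓝[>] 0) (𝓝 (s m)))
    (n : ℕ) (hz : z ∈ doublyCutPlane) :
    reflectionSum p n (1 - z) + reflectionSum n p z +
      (-log z) ^ (p + 1) / ((p + 1)! : ℂ) * ((-log (1 - z)) ^ (n + 1) / ((n + 1)! : ℂ)) = s n := by
  refine eqOn_of_hasDerivAt_of_tendsto (f' := 0) (g := fun _ => s n)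
    (f := fun z => reflectionSum p n (1 - z) + reflectionSum n p z +
      (-log z) ^ (p + 1) / ((p + 1)! : ℂ) * ((-log (1 - z)) ^ (n + 1) / ((n + 1)! : ℂ)))
    isOpen_doublyCutPlane isPreconnected_doublyCutPlane (fun w hw => ?_)
    (fun w _ => hasDerivAt_const w _) eventually_ofReal_mem_doublyCutPlane ?_
    tendsto_const_nhds hz
  · have hreflect := (hasDerivAt_reflectionSum p n (one_sub_mem_doublyCutPlane hw)).comp w
      ((hasDerivAt_id w).const_sub 1)
    have hlog := hasDerivAt_pow_succ_div_factorial (hasDerivAt_log hw.1).fun_neg p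
    have hlog' := hasDerivAt_pow_succ_div_factorial (hasDerivAt_log_one_sub hw.2).fun_neg n
    refine ((hreflect.add (hasDerivAt_reflectionSum n p hw)).add (hlog.mul hlog')).congr_deriv ?_
    simp only [sub_sub_cancel, Pi.zero_apply]
    ring
  · have hproduct : Tendsto (fun x : ℝ => (-log (x : ℂ)) ^ (p + 1) / ((p + 1)! : ℂ) *
        ((-log (1 - (x : ℂ))) ^ (n + 1) / ((n + 1)! : ℂ))) (𝓝[>] 0) (𝓝 0) :=
      tendsto_neg_log_pow_div_factorial_mul_nielsenIter n.succ_ne_zero 0 (p + 1)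
    simpa using ((tendsto_reflectionSum_one_sub hs n).add (tendsto_reflectionSum n p)).add hproduct

theorem nielsenIter_one_sub {p : ℕ} {s : ℕ → ℂ}
    (hs : ∀ m, Tendsto (fun x : ℝ => nielsenIter (m + 1) (p + 1) (1 - x)) (𝓝[>] 0) (𝓝 (s m)))
    (n : ℕ) (hz : z ∈ doublyCutPlane) :
    nielsenIter (n + 1) (p + 1) (1 - z) =
      expConv (log (1 - z)) (fun m => s m - reflectionSum m p z - (-log z) ^ (p + 1) /
        ((p + 1)! : ℂ) * ((-log (1 - z)) ^ (m + 1) / ((m + 1)! : ℂ))) n := by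
  have hsum : (fun m => s m - reflectionSum m p z - (-log z) ^ (p + 1) / ((p + 1)! : ℂ) *
      ((-log (1 - z)) ^ (m + 1) / ((m + 1)! : ℂ))) =
      expConv (-log (1 - z)) fun m => nielsenIter (m + 1) (p + 1) (1 - z) := by
    funext m
    have h := reflectionSum_one_sub_add_reflectionSum hs m hz
    rw [reflectionSum] at h
    linear_combination -h
  have hinv := congrFun (expConv_neg_expConv (-log (1 - z))
    fun m => nielsenIter (m + 1) (p + 1) (1 - z)) n
  rw [neg_neg] at hinv
  rw [hsum, hinv]

/-- The right-hand side `∑ (-1)^{p+1+k} C(p+k, k) S_{n-k, p+1+k}(z)`, `k ≤ n`, of the transformation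
of `S_{n,p+1}` under `z ↦ z / (z - 1)`. -/
noncomputable def landenSum (n p : ℕ) (z : ℂ) : ℂ :=
  ∑ k ∈ Finset.range (n + 1),
    (-1) ^ (p + 1 + k) * ((p + k).choose k : ℂ) * nielsenIter (n - k) (p + 1 + k) z

theorem nielsenIter_zero_div_sub_one (p : ℕ) (hz : z ∈ cutPlane) :
    nielsenIter 0 p (z / (z - 1)) = log (1 - z) ^ p / (p ! : ℂ) := by
  rw [nielsenIter_zero, log_one_sub_div_sub_one hz, neg_neg]

theorem hasDerivAt_nielsenIter_div_sub_one {p : ℕ} (hp : p ≠ 0) (n : ℕ) (hz : z ∈ cutPlane)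
    (hz₀ : z ≠ 0) :
    HasDerivAt (fun z => nielsenIter (n + 1) p (z / (z - 1)))
      (nielsenIter n p (z / (z - 1)) / z - -(1 - z)⁻¹ * nielsenIter n p (z / (z - 1))) z := by
  have h₁ : 1 - z ≠ 0 := slitPlane_ne_zero hz
  have h₂ : z - 1 ≠ 0 := sub_ne_zero.2 (ne_one_of_mem_cutPlane hz)
  have hquot := (hasDerivAt_id z).fun_div ((hasDerivAt_id z).sub_const 1) h₂
  refine ((hasDerivAt_nielsenIter_succ hp n (div_sub_one_mem_cutPlane hz)
    (div_ne_zero hz₀ h₂)).comp z hquot).congr_deriv ?_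
  simp only [id]
  field_simp
  ring

theorem hasDerivAt_expConv_nielsenIter_div_sub_one (n p : ℕ) (hz : z ∈ cutPlane) (hz₀ : z ≠ 0) :
    HasDerivAt
      (fun z => expConv (log (1 - z)) (fun m => nielsenIter m (p + 1) (z / (z - 1))) (n + 1))
      (expConv (log (1 - z)) (fun m => nielsenIter m (p + 1) (z / (z - 1))) n / z -
        log (1 - z) ^ (n + 1) / ((n + 1)! : ℂ) * (log (1 - z) ^ p / (p ! : ℂ)) * (1 - z)⁻¹) z := by
  have hlog := hasDerivAt_log_one_sub hz
  have hzero : HasDerivAt (fun z => nielsenIter 0 (p + 1) (z / (z - 1)))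
      (log (1 - z) ^ p / (p ! : ℂ) * -(1 - z)⁻¹) z := by
    refine (hasDerivAt_pow_succ_div_factorial hlog p).congr_of_eventuallyEq ?_
    filter_upwards [isOpen_cutPlane.mem_nhds hz] with w hw using nielsenIter_zero_div_sub_one _ hw
  refine (hasDerivAt_expConv (U := fun m z => nielsenIter m (p + 1) (z / (z - 1)))
    (V := fun m => m.casesOn (log (1 - z) ^ p / (p ! : ℂ) * -(1 - z)⁻¹)
      fun m => nielsenIter m (p + 1) (z / (z - 1)) / z) hlog hzero
    (fun m => hasDerivAt_nielsenIter_div_sub_one p.succ_ne_zero m hz hz₀) (n + 1)).congr_deriv ?_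
  rw [expConv_succ]
  simp only [expConv, Finset.sum_div, mul_div_assoc]
  change _ + _ * (log (1 - z) ^ p / (p ! : ℂ) * -(1 - z)⁻¹) = _
  ring

theorem neg_one_pow_mul_choose_mul_nielsenIter_zero (k p : ℕ) (z : ℂ) :
    (-1) ^ (p + 1 + k) * ((p + k).choose k : ℂ) * nielsenIter 0 (p + k) z =
      -(log (1 - z) ^ k / (k ! : ℂ) * (log (1 - z) ^ p / (p ! : ℂ))) := by
  have hsign : (-1 : ℂ) ^ (k + p) * (-1) ^ (k + p) = 1 := by
    rw [← mul_pow]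
    norm_num
  rw [pow_div_factorial_mul_pow_div_factorial, nielsenIter_zero, neg_pow (log _), add_right_comm,
    pow_succ, add_comm p]
  linear_combination
    -((k + p).choose k : ℂ) * (log (1 - z) ^ (k + p) / ((k + p)! : ℂ)) * hsign

theorem hasDerivAt_landenSum_succ (n p : ℕ) (hz : z ∈ cutPlane) (hz₀ : z ≠ 0) :
    HasDerivAt (landenSum (n + 1) p)
      (landenSum n p z / z -
        log (1 - z) ^ (n + 1) / ((n + 1)! : ℂ) * (log (1 - z) ^ p / (p ! : ℂ)) * (1 - z)⁻¹) z := by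
  have hterm : ∀ k ∈ Finset.range (n + 1), HasDerivAt
      (fun z => (-1) ^ (p + 1 + k) * ((p + k).choose k : ℂ) *
        nielsenIter (n + 1 - k) (p + 1 + k) z)
      ((-1) ^ (p + 1 + k) * ((p + k).choose k : ℂ) *
        (nielsenIter (n - k) (p + 1 + k) z / z)) z := by
    intro k hk
    rw [Nat.sub_add_comm (Nat.lt_succ_iff.1 (Finset.mem_range.1 hk))]
    exact (hasDerivAt_nielsenIter_succ (by lia) _ hz hz₀).const_mul _
  have hlast : HasDerivAt (nielsenIter 0 (p + 1 + (n + 1)))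
      (nielsenIter 0 (p + (n + 1)) z * (1 - z)⁻¹) z := by
    rw [add_right_comm]
    exact hasDerivAt_nielsenIter_zero_succ (p + (n + 1)) hz
  unfold landenSum
  simp only [Finset.sum_range_succ _ (n + 1), Nat.sub_self]
  refine ((HasDerivAt.fun_sum hterm).fun_add (hlast.const_mul _)).congr_deriv ?_
  rw [← mul_assoc, neg_one_pow_mul_choose_mul_nielsenIter_zero, neg_mul, ← sub_eq_add_neg]
  simp only [Finset.sum_div, mul_div_assoc]

theorem tendsto_landenSum (n p : ℕ) :
    Tendsto (fun x : ℝ => landenSum n p x) (𝓝[>] 0) (𝓝 0) := by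
  simpa [landenSum] using tendsto_finsetSum (Finset.range (n + 1)) fun k _ =>
    (tendsto_nielsenIter_comp (p := p + 1 + k) (by lia) (n - k)
      tendsto_ofReal_nhdsGT_zero).const_mul ((-1) ^ (p + 1 + k) * ((p + k).choose k : ℂ))

theorem tendsto_expConv_nielsenIter_div_sub_one (n p : ℕ) :
    Tendsto (fun x : ℝ =>
      expConv (log (1 - x)) (fun m => nielsenIter m (p + 1) (x / (x - 1))) n) (𝓝[>] 0) (𝓝 0) := by
  have hquot : Tendsto (fun x : ℝ => (x : ℂ) / (x - 1)) (𝓝[>] 0) (𝓝 0) := by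
    simpa [Pi.div_def] using
      tendsto_ofReal_nhdsGT_zero.div (tendsto_ofReal_nhdsGT_zero.sub_const 1) (by simp)
  have h := tendsto_expConv (a := fun m (x : ℝ) => nielsenIter m (p + 1) (x / (x - 1)))
    tendsto_log_one_sub_nhdsGT_zero
    (fun m => tendsto_nielsenIter_comp p.succ_ne_zero m hquot) n
  rwa [expConv_zero] at h

theorem expConv_nielsenIter_div_sub_one (n p : ℕ) (hz : z ∈ doublyCutPlane) :
    expConv (log (1 - z)) (fun m => nielsenIter m (p + 1) (z / (z - 1))) n = landenSum n p z := by
  induction n generalizing z with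
  | zero =>
    simp [expConv, landenSum, nielsenIter_zero_div_sub_one _ hz.2, nielsenIter_zero,
      ← mul_div_assoc, ← mul_pow]
  | succ n ih =>
    refine eqOn_of_hasDerivAt_of_tendsto
      (f := fun z => expConv (log (1 - z)) (fun m => nielsenIter m (p + 1) (z / (z - 1))) (n + 1))
      isOpen_doublyCutPlane isPreconnected_doublyCutPlane
      (fun w hw => ?_) (fun w hw => hasDerivAt_landenSum_succ n p hw.2 (slitPlane_ne_zero hw.1))
      eventually_ofReal_mem_doublyCutPlane (tendsto_expConv_nielsenIter_div_sub_one (n + 1) p)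
      (tendsto_landenSum (n + 1) p) hz
    rw [← ih hw]
    exact hasDerivAt_expConv_nielsenIter_div_sub_one n p hw.2 (slitPlane_ne_zero hw.1)

theorem nielsenIter_div_sub_one (n p : ℕ) (hz : z ∈ doublyCutPlane) :
    nielsenIter n (p + 1) (z / (z - 1)) =
      expConv (-log (1 - z)) (fun m => landenSum m p z) n := by
  have hsum := funext fun m => expConv_nielsenIter_div_sub_one m p hz
  rw [← hsum, expConv_neg_expConv]

end FunctionalEquations

theorem mainTheorem9 (z : ℂ)
    (hz : z ∉ (fun x : ℝ => (x : ℂ)) '' (Set.Iic 0 ∪ Set.Ici 1)) :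
    nielsenPolylog 4 2 (1 - z) + nielsenPolylog 4 2 z + nielsenPolylog 4 2 (z / (z - 1)) =
      2 * classicalPolylog 6 (1 - z) + 2 * classicalPolylog 6 z
        + 2 * classicalPolylog 6 (z / (z - 1))
        - (classicalPolylog 5 z - classicalPolylog 5 (z / (z - 1))) * Complex.log (1 - z)
        - classicalPolylog 5 (1 - z) * Complex.log z
        - 3 / (Nat.factorial 6 : ℂ) * Complex.log (1 - z) ^ 6
        + 2 / (Nat.factorial 5 : ℂ) * Complex.log z * Complex.log (1 - z) ^ 5
        - 1 / ((Nat.factorial 2 : ℂ) * (Nat.factorial 4 : ℂ))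
            * Complex.log z ^ 2 * Complex.log (1 - z) ^ 4
        - 2 / (Nat.factorial 4 : ℂ) * riemannZeta 2 * Complex.log (1 - z) ^ 4
        + 1 / (Nat.factorial 3 : ℂ) * riemannZeta 2 * Complex.log z * Complex.log (1 - z) ^ 3
        - 1 / (Nat.factorial 3 : ℂ) * riemannZeta 3 * Complex.log (1 - z) ^ 3
        + 1 / (Nat.factorial 2 : ℂ) * riemannZeta 3 * Complex.log z * Complex.log (1 - z) ^ 2
        - 7 / (4 * (Nat.factorial 2 : ℂ)) * riemannZeta 4 * Complex.log (1 - z) ^ 2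
        + riemannZeta 4 * Complex.log z * Complex.log (1 - z)
        + riemannZeta 5 * Complex.log z
        - riemannZeta 2 * riemannZeta 3 * Complex.log (1 - z)
        - (1 / 2 * riemannZeta 3 ^ 2 + 5 / 4 * riemannZeta 6) := by
  have hD := mem_doublyCutPlane_of_notMem hz
  have hD' := one_sub_mem_doublyCutPlane hD
  have reflect₁ (n : ℕ) := nielsenIter_one_sub tendsto_nielsenIter_one_one_sub n hD
  have reflect₂ (n : ℕ) := nielsenIter_one_sub tendsto_nielsenIter_two_one_sub n hD
  have landen (n p : ℕ) := nielsenIter_div_sub_one n p hD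
  rw [nielsenPolylog_succ_eq_nielsenIter two_ne_zero 3 hD'.2,
    nielsenPolylog_succ_eq_nielsenIter two_ne_zero 3 hD.2,
    nielsenPolylog_succ_eq_nielsenIter two_ne_zero 3 (div_sub_one_mem_cutPlane hD.2)]
  simp only [classicalPolylog_succ_eq_nielsenIter, reflect₁ 3, reflect₁ 4, reflect₂ 3, landen 4 0,
    landen 5 0, landen 4 1, zero_add, Nat.reduceAdd]
  simp only [expConv, reflectionSum, landenSum, nielsenIter_zero, Finset.sum_range_succ,
    Finset.sum_range_zero, doubleZeta_two_one, doubleZeta_three_one, doubleZeta_four_one,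
    doubleZeta_five_one, riemannZeta_ofNat_eq_realZeta, Nat.factorial, Nat.choose,
    Nat.reduceAdd, Nat.reduceSub]
  push_cast
  ring
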